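/- Let $H$ be a real separable Hilbert space with norm $|\cdot|$ and inner product $\langle\cdot,\cdot\rangle$. Let $(U(t,s))_{t\ge s}$, $s,t\in\mathbb R$, be an evolution family of bounded linear operators on $H$: $U(s,s)=I$, $U(t,r)U(r,s)=U(t,s)$ for $t\ge r\ge s$, and $(t,s)\mapsto U(t,s)x$ is continuous on $\{t\ge s\}$ for every $x\in H$. For $t\ge s$ let $\mu_{t,s}$ be an infinitely divisible Borel probability measure on $H$ with $$\int_H e^{i\langle x,\xi\rangle}\mu_{t,s}(dx)=\exp\Bigl(i\langle a_{t,s},\xi\rangle-\tfrac12\langle\xi,R_{t,s}\xi\rangle+\int_H\Bigl(e^{i\langle\xi,x\rangle}-1-\tfrac{i\langle\xi,x\rangle}{1+|x|^2}\Bigr)\mathrm m_{t,s}(dx)\Bigr),\qquad \xi\in H,$$ where $a_{t,s}\in H$, $R_{t,s}$ is a non-negative symmetric trace class operator, and $\mathrm m_{t,s}$ is a Lévy measure ($\mathrm m_{t,s}(\{0\})=0$ and $\int_H\min(1,|x|^2)\,\mathrm m_{t,s}(dx)<\infty$). Suppose that $\mu_{t,s}=\mu_{t,r}*(\mu_{r,s}\circ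 U(t,r)^{-1})$ for all $t\ge r\ge s$, and put $$p_{s,t}f(x)=\int_H f(U(t,s)x+y)\,\mu_{t,s}(dy).$$ Let $(\nu_t)_{t\in\mathbb R}$ be an evolution system of measures for $(p_{s,t})$, i.e. Borel probability measures on $H$ with $\int_H p_{s,t}f\,d\nu_s=\int_H f\,d\nu_t$ for all $s\le t$ and all bounded Borel functions $f$. Let $|\Gamma_{t,s}x|=|R_{t,s}^{-1/2}U(t,s)x|$, where $R_{t,s}^{-1/2}$ is the pseudo-inverse of $R_{t,s}^{1/2}$ (the preimage orthogonal to $\ker R_{t,s}^{1/2}$), and $|\Gamma_{t,s}x|=\infty$ if $U(t,s)x\notin R_{t,s}^{1/2}(H)$. For $s\le t$, $\alpha>1$ and $\varepsilon>0$ set $$C_{s,t}(\alpha,\varepsilon):=\int_H\Bigl[\int_H\exp\Bigl(-\frac{\alpha|\Gamma_{t,s}(x-y)|^2}{2(\alpha-1)}\Bigr)\nu_s(dy)\Bigr]^{-(1+\varepsilon)}\nu_s(dx)\in[0,\infty],$$ with $e^{-\infty}=0$, $0^{-(1+\varepsilon)}=\infty$. Then for all $s\le t$, $\alpha>1$, $\varepsilon>0$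 and every $f\in L^\alpha(H,\nu_t)$, the integral defining $p_{s,t}f(x)$ converges absolutely for $\nu_s$-almost every $x$, the function $p_{s,t}f$ is $\nu_s$-measurable, and $$\|p_{s,t}f\|_{L^{\alpha(1+\varepsilon)}(H,\nu_s)}\le C_{s,t}(\alpha,\varepsilon)^{\frac1{\alpha(1+\varepsilon)}}\,\|f\|_{L^\alpha(H,\nu_t)},$$ where $\infty\cdot 0=0$ on the right-hand side. -/

import Mathlib

open MeasureTheory
open scoped ENNReal InnerProductSpace

noncomputable section

namespace Mehler

section SquareRoot

variable {H : Type*} [NormedAddCommGroup H] [InnerProductSpace ℝ H]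

/-! ### Square roots of positive operators and pseudo-inverses -/

/-- Scalar majorant of the iteration below. -/
def sqrtScalar : ℕ → ℝ
  | 0 => 0
  | n + 1 => (1 + sqrtScalar n ^ 2) / 2

/-- The iteration `Y₀ = 0`, `Yₙ₊₁ = (A + Yₙ²) / 2`, whose limit is `1 - (1 - A)^{1/2}`. -/
def sqrtIter (A : H →L[ℝ] H) : ℕ → (H →L[ℝ] H)
  | 0 => 0
  | n + 1 => (2⁻¹ : ℝ) • (A + sqrtIter A n * sqrtIter A n)

lemma sqrtScalar_bounds (n : ℕ) : 0 ≤ sqrtScalar n ∧ sqrtScalar n ≤ 1 := by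
  induction n with
  | zero => simp [sqrtScalar]
  | succ n ih =>
    simp only [sqrtScalar]
    constructor
    · positivity
    · nlinarith [ih.1, ih.2]

lemma sqrtScalar_step (n : ℕ) : sqrtScalar n ≤ sqrtScalar (n + 1) := by
  simp only [sqrtScalar]
  nlinarith [sq_nonneg (sqrtScalar n - 1)]

lemma sqrtIter_norm {A : H →L[ℝ] H} (hA : ‖A‖ ≤ 1) (n : ℕ) :
    ‖sqrtIter A n‖ ≤ sqrtScalar n := by
  induction n with
  | zero => simp [sqrtIter, sqrtScalar]
  | succ n ih =>
    simp only [sqrtIter, sqrtScalar]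
    have h1 : ‖A + sqrtIter A n * sqrtIter A n‖ ≤ 1 + sqrtScalar n ^ 2 := by
      refine (norm_add_le _ _).trans (add_le_add hA ((norm_mul_le _ _).trans ?_))
      nlinarith [norm_nonneg (sqrtIter A n)]
    rw [norm_smul, Real.norm_of_nonneg (by norm_num)]
    linarith

lemma sqrtIter_commute {A B : H →L[ℝ] H} (hB : Commute B A) (n : ℕ) :
    Commute B (sqrtIter A n) := by
  induction n with
  | zero => exact Commute.zero_right _
  | succ n ih => exact (hB.add_right (ih.mul_right ih)).smul_right _

lemma sqrtIter_diff {A : H →L[ℝ] H} (hA : ‖A‖ ≤ 1) (n : ℕ) :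
    ‖sqrtIter A (n + 1) - sqrtIter A n‖ ≤ sqrtScalar (n + 1) - sqrtScalar n := by
  induction n with
  | zero =>
    simpa [sqrtIter, sqrtScalar] using sqrtIter_norm hA 1
  | succ n ih =>
    have hc : Commute (sqrtIter A (n + 1)) (sqrtIter A n) :=
      sqrtIter_commute (sqrtIter_commute (Commute.refl A) (n + 1)).symm n
    have e : sqrtIter A (n + 1 + 1) - sqrtIter A (n + 1) = (2⁻¹ : ℝ) •
        ((sqrtIter A (n + 1) + sqrtIter A n) * (sqrtIter A (n + 1) - sqrtIter A n)) := by
      rw [← hc.mul_self_sub_mul_self_eq]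
      conv_lhs => rw [sqrtIter]; arg 2; rw [sqrtIter]
      rw [← smul_sub]
      congr 1
      abel
    have e' : sqrtScalar (n + 1 + 1) - sqrtScalar (n + 1) = 2⁻¹ *
        ((sqrtScalar (n + 1) + sqrtScalar n) * (sqrtScalar (n + 1) - sqrtScalar n)) := by
      conv_lhs => rw [sqrtScalar]; arg 2; rw [sqrtScalar]
      ring
    rw [e, e', norm_smul, Real.norm_of_nonneg (by norm_num)]
    refine mul_le_mul_of_nonneg_left ((norm_mul_le _ _).trans ?_) (by norm_num)
    refine mul_le_mul ?_ ih (norm_nonneg _) ?_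
    · exact (norm_add_le _ _).trans (add_le_add (sqrtIter_norm hA _) (sqrtIter_norm hA _))
    · exact add_nonneg (sqrtScalar_bounds _).1 (sqrtScalar_bounds _).1

lemma sqrtIter_symm {A : H →L[ℝ] H} (hA : A.IsSymmetric) (n : ℕ) :
    (sqrtIter A n).IsSymmetric := by
  induction n with
  | zero => intro x y; simp [sqrtIter]
  | succ n ih =>
    intro x y
    have h1 := hA x y
    have h2 : ⟪sqrtIter A n (sqrtIter A n x), y⟫_ℝ = ⟪x, sqrtIter A n (sqrtIter A n y)⟫_ℝ :=
      (ih _ _).trans (ih _ _)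
    simp only [ContinuousLinearMap.coe_coe] at h1
    simp [sqrtIter, inner_smul_left, inner_smul_right, inner_add_left, inner_add_right, h1, h2]

variable [CompleteSpace H]

/-- A positive contraction has a positive square root, which commutes with everything that
commutes with the operator. -/
lemma exists_sqrt_of_norm_le {R : H →L[ℝ] H} (hR : R.IsPositive) (h1 : ‖R‖ ≤ 1) :
    ∃ S : H →L[ℝ] H, S.IsPositive ∧ S * S = R ∧ ∀ B, Commute B R → Commute B S := by
  have hRx : ∀ x, ‖R x‖ ^ 2 ≤ ⟪R x, x⟫_ℝ := by
    intro x
    have h := hR.inner_nonneg_left (x - R x)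
    have h2 : ⟪R (R x), x⟫_ℝ = ⟪R x, R x⟫_ℝ := hR.inner_left_eq_inner_right _ _
    have h3 : ⟪R (R x), R x⟫_ℝ ≤ ‖R x‖ ^ 2 := by
      refine (real_inner_le_norm _ _).trans ?_
      have := R.le_of_opNorm_le h1 (R x)
      nlinarith [norm_nonneg (R x)]
    have h4 : ⟪R x, R x⟫_ℝ = ‖R x‖ ^ 2 := real_inner_self_eq_norm_sq _
    simp only [map_sub, inner_sub_left, inner_sub_right] at h
    linarith
  set A : H →L[ℝ] H := 1 - R with hAdef
  have hA : ‖A‖ ≤ 1 := by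
    refine ContinuousLinearMap.opNorm_le_bound _ zero_le_one fun x => ?_
    rw [one_mul]
    refine (sq_le_sq₀ (norm_nonneg _) (norm_nonneg _)).1 ?_
    have e : A x = x - R x := by simp [A]
    rw [e, norm_sub_sq_real, real_inner_comm]
    nlinarith [hRx x, sq_nonneg ‖R x‖]
  have hAs : A.IsSymmetric := by
    intro x y
    have : ⟪R x, y⟫_ℝ = ⟪x, R y⟫_ℝ := hR.inner_left_eq_inner_right _ _
    simp [A, inner_sub_left, inner_sub_right, this]
  have hsum : Summable fun n => sqrtScalar (n + 1) - sqrtScalar n := by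
    refine summable_of_sum_range_le (c := 1) (fun n => sub_nonneg.2 (sqrtScalar_step n)) fun n => ?_
    rw [Finset.sum_range_sub]
    have := (sqrtScalar_bounds n).2
    simpa [sqrtScalar] using this
  have hcau : CauchySeq (sqrtIter A) := by
    refine cauchySeq_of_summable_dist (Summable.of_nonneg_of_le (fun _ => dist_nonneg)
      (fun n => ?_) hsum)
    rw [dist_comm, dist_eq_norm]
    exact sqrtIter_diff hA n
  obtain ⟨Y, hY⟩ := cauchySeq_tendsto_of_complete hcau
  have hYn : ‖Y‖ ≤ 1 := le_of_tendsto hY.norm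
    (Filter.Eventually.of_forall fun n => (sqrtIter_norm hA n).trans (sqrtScalar_bounds n).2)
  have hYeq : Y = (2⁻¹ : ℝ) • (A + Y * Y) :=
    tendsto_nhds_unique ((Filter.tendsto_add_atTop_iff_nat 1).2 hY)
      (((hY.mul hY).const_add A).const_smul (2⁻¹ : ℝ))
  have hYap : ∀ x, Filter.Tendsto (fun n => sqrtIter A n x) Filter.atTop (nhds (Y x)) := fun x =>
    ((ContinuousLinearMap.apply ℝ H x).continuous.tendsto Y).comp hY
  have hYs : ∀ x y, ⟪Y x, y⟫_ℝ = ⟪x, Y y⟫_ℝ := fun x y =>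
    tendsto_nhds_unique ((hYap x).inner tendsto_const_nhds)
      ((tendsto_const_nhds.inner (hYap y)).congr fun n => (sqrtIter_symm hAs n x y).symm)
  refine ⟨1 - Y, (ContinuousLinearMap.isPositive_iff _).2 ⟨fun x y => ?_, fun x => ?_⟩, ?_,
    fun B hB => ?_⟩
  · simp [inner_sub_left, inner_sub_right, hYs x y]
  · have h2 : ⟪Y x, x⟫_ℝ ≤ ‖x‖ ^ 2 := by
      refine (real_inner_le_norm _ _).trans ?_
      have := Y.le_of_opNorm_le hYn x
      nlinarith [norm_nonneg x]
    have e : (1 - Y) x = x - Y x := by simp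
    rw [e, inner_sub_left, real_inner_self_eq_norm_sq]
    linarith
  · have h2 : Y + Y = A + Y * Y := by
      conv_lhs => rw [← two_smul ℝ Y, hYeq, smul_smul]
      norm_num
    have : (1 - Y) * (1 - Y) = 1 - (Y + Y) + Y * Y := by noncomm_ring
    rw [this, h2, hAdef]
    abel
  · have hBA : Commute B A := (Commute.one_right B).sub_right hB
    refine (Commute.one_right B).sub_right ?_
    exact tendsto_nhds_unique (hY.const_mul B)
      ((hY.mul_const B).congr fun n => (sqrtIter_commute hBA n).eq.symm)

/-- Every positive operator has exactly one positive square root. -/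
theorem existsUnique_sqrt {R : H →L[ℝ] H} (hR : R.IsPositive) :
    ∃! S : H →L[ℝ] H, S.IsPositive ∧ S * S = R := by
  obtain ⟨S, hS, hSR, hSc⟩ : ∃ S : H →L[ℝ] H, S.IsPositive ∧ S * S = R ∧
      ∀ B, Commute B R → Commute B S := by
    set c : ℝ := ‖R‖ + 1 with hc
    have hc0 : 0 < c := by positivity
    have hpos : (c⁻¹ • R).IsPositive := hR.smul_of_nonneg (by positivity)
    obtain ⟨S, h1, h2, h3⟩ := exists_sqrt_of_norm_le hpos (by
      rw [norm_smul, norm_inv, Real.norm_of_nonneg hc0.le, inv_mul_le_iff₀ hc0]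
      linarith)
    refine ⟨√c • S, h1.smul_of_nonneg (Real.sqrt_nonneg c), ?_, fun B hB => ?_⟩
    · rw [smul_mul_smul_comm, Real.mul_self_sqrt hc0.le, h2, smul_smul,
        mul_inv_cancel₀ hc0.ne', one_smul]
    · exact (h3 B (hB.smul_right _)).smul_right _
  refine ⟨S, ⟨hS, hSR⟩, fun T hT => ?_⟩
  obtain ⟨hT, hTR⟩ := hT
  have hTS : T * S = S * T := (hSc T (by 
    rw [← hTR]
    exact (Commute.refl T).mul_right (Commute.refl T))).eq
  set D : H →L[ℝ] H := S - T with hD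
  have hDs : ∀ x y, ⟪D x, y⟫_ℝ = ⟪x, D y⟫_ℝ := by
    intro x y
    have h1 := hS.inner_left_eq_inner_right x y
    have h2 := hT.inner_left_eq_inner_right x y
    simp [D, inner_sub_left, inner_sub_right, h1, h2]
  have hz : ∀ x, S (D x) + T (D x) = 0 := by
    intro x
    have : (S + T) * D = 0 := by
      rw [hD, add_mul, mul_sub, mul_sub, hSR, hTR, hTS]
      abel
    simpa using congrArg (fun F : H →L[ℝ] H => F x) this
  have key : ∀ P : H →L[ℝ] H, P.IsPositive → (∀ x, ⟪P (D x), D x⟫_ℝ = 0) →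
      ∀ x, D (P (D x)) = 0 := by
    intro P hP h x
    have hs : ∀ x y, ⟪D (P (D x)), y⟫_ℝ = ⟪x, D (P (D y))⟫_ℝ := fun x y => by
      rw [hDs, hP.inner_left_eq_inner_right, hDs]
    have h0 : (((D * P * D : H →L[ℝ] H) : H →ₗ[ℝ] H)) = 0 :=
      (LinearMap.IsSymmetric.inner_map_self_eq_zero (fun x y => hs x y)).1
        fun x => (hDs _ _).trans (h x)
    exact congrArg (fun F : H →ₗ[ℝ] H => F x) h0
  have hq : ∀ x, ⟪S (D x), D x⟫_ℝ = 0 ∧ ⟪T (D x), D x⟫_ℝ = 0 := by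
    intro x
    have h1 := hS.inner_nonneg_left (D x)
    have h2 := hT.inner_nonneg_left (D x)
    have h3 : ⟪S (D x), D x⟫_ℝ + ⟪T (D x), D x⟫_ℝ = 0 := by
      rw [← inner_add_left, hz, inner_zero_left]
    exact ⟨by linarith, by linarith⟩
  have h3 : ∀ x, D (D (D x)) = 0 := by
    intro x
    have e : D (D x) = S (D x) - T (D x) := by simp [D]
    rw [e, map_sub, key S hS (fun x => (hq x).1), key T hT (fun x => (hq x).2), sub_zero]
  have h2 : ∀ x, D (D x) = 0 := fun x => by
    rw [← inner_self_eq_zero (𝕜 := ℝ), hDs, h3, inner_zero_right]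
  have h1 : ∀ x, D x = 0 := fun x => by
    rw [← inner_self_eq_zero (𝕜 := ℝ), hDs, h2, inner_zero_right]
  have : D = 0 := ContinuousLinearMap.ext h1
  exact (sub_eq_zero.1 this).symm

open Classical in
/-- The positive square root `R^{1/2}` of a positive operator `R` (and `0` if `R` is not
positive). -/
def sqrtOp (R : H →L[ℝ] H) : H →L[ℝ] H :=
  if hR : R.IsPositive then (existsUnique_sqrt hR).exists.choose else 0

theorem sqrtOp_spec {R : H →L[ℝ] H} (hR : R.IsPositive) :
    (sqrtOp R).IsPositive ∧ sqrtOp R * sqrtOp R = R := by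
  rw [sqrtOp, dif_pos hR]
  exact (existsUnique_sqrt hR).exists.choose_spec

open Classical in
/-- The pseudo-inverse `T⁻¹` of a bounded operator `T`, as a map on the range of `T`: for `v` in the
range of `T`, the preimage of `v` that is orthogonal to `ker T` (the preimage of minimal norm).
Outside the range of `T` the value is `0` and is never used. -/
def pseudoInverse (T : H →L[ℝ] H) (v : H) : H :=
  if h : ∃ u, u ∈ (T : H →ₗ[ℝ] H).kerᗮ ∧ T u = v then h.choose else 0

theorem pseudoInverse_spec (T : H →L[ℝ] H) {v : H} (hv : v ∈ (T : H →ₗ[ℝ] H).range) :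
    pseudoInverse T v ∈ (T : H →ₗ[ℝ] H).kerᗮ ∧ T (pseudoInverse T v) = v := by
  obtain ⟨u, hu⟩ := hv
  have : CompleteSpace (T : H →ₗ[ℝ] H).ker :=
    (ContinuousLinearMap.isClosed_ker T).completeSpace_coe
  obtain ⟨k, hk, w, hw, rfl⟩ :=
    (T : H →ₗ[ℝ] H).ker.exists_add_mem_mem_orthogonal u
  have h : ∃ u, u ∈ (T : H →ₗ[ℝ] H).kerᗮ ∧ T u = v := ⟨w, hw, by
    have hk' : T k = 0 := hk
    simpa [hk'] using hu⟩
  rw [pseudoInverse, dif_pos h]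
  exact h.choose_spec

end SquareRoot

/-! ### The generalized Mehler semigroup -/

section Semigroup

variable {H : Type*} [NormedAddCommGroup H] [InnerProductSpace ℝ H]

/-- `(U(t,s))_{t ≥ s}` is an evolution family of bounded operators; only the values `U t s` with
`s ≤ t` matter. -/
structure IsEvolutionFamily (U : ℝ → ℝ → H →L[ℝ] H) : Prop where
  self_eq_one : ∀ s, U s s = 1
  comp : ∀ s r t, s ≤ r → r ≤ t → (U t r).comp (U r s) = U t s
  stronglyContinuous : ∀ x : H, ContinuousOn (fun p : ℝ × ℝ => U p.1 p.2 x) {p | p.2 ≤ p.1}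

/-- Non-negative symmetric trace class operators. -/
def IsPosTraceClass (R : H →L[ℝ] H) : Prop :=
  R.IsPositive ∧ ∀ (w : Set H) (b : HilbertBasis w ℝ H), Summable fun i => ⟪b i, R (b i)⟫_ℝ

variable [MeasurableSpace H]

/-- Lévy measures on `H`: no mass at `0`, and `∫ min(1, |x|²) m(dx) < ∞`. -/
structure IsLevyMeasure (m : Measure H) : Prop where
  zero : m {0} = 0
  lintegral_lt_top : ∫⁻ x, min 1 (‖x‖ₑ ^ 2) ∂m < ∞

/-- The Lévy-Khintchine symbol
`ψ(ξ) = -i⟨a,ξ⟩ + ½⟨ξ,Rξ⟩ - ∫ (e^{i⟨ξ,x⟩} - 1 - i⟨ξ,x⟩/(1+|x|²)) m(dx)`. -/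
def levySymbol (a : H) (R : H →L[ℝ] H) (m : Measure H) (ξ : H) : ℂ :=
  -(Complex.I * (⟪a, ξ⟫_ℝ : ℂ)) + (1 / 2 : ℂ) * (⟪ξ, R ξ⟫_ℝ : ℂ)
    - ∫ x, (Complex.exp (Complex.I * (⟪ξ, x⟫_ℝ : ℂ)) - 1
        - Complex.I * (⟪ξ, x⟫_ℝ : ℂ) / ((1 + ‖x‖ ^ 2 : ℝ) : ℂ)) ∂m

/-- `μ` is the infinitely divisible probability measure `D[a, R, m]`. -/
structure HasLevyTriplet (μ : Measure H) (a : H) (R : H →L[ℝ] H) (m : Measure H) : Prop where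
  isProbabilityMeasure : IsProbabilityMeasure μ
  posTraceClass : IsPosTraceClass R
  levyMeasure : IsLevyMeasure m
  charFun_eq : ∀ ξ : H, charFun μ ξ = Complex.exp (-levySymbol a R m ξ)

/-- The skew convolution equation `μ_{t,s} = μ_{t,r} * (μ_{r,s} ∘ U(t,r)⁻¹)` for `s ≤ r ≤ t`. -/
def SkewConvolution (U : ℝ → ℝ → H →L[ℝ] H) (μ : ℝ → ℝ → Measure H) : Prop :=
  ∀ s r t, s ≤ r → r ≤ t → μ t s = (μ t r).conv ((μ r s).map (U t r))

/-- The generalized Mehler semigroup `p_{s,t} f(x) = ∫ f(U(t,s)x + y) μ_{t,s}(dy)`. -/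
def mehler (U : ℝ → ℝ → H →L[ℝ] H) (μ : ℝ → ℝ → Measure H) (s t : ℝ) (f : H → ℝ) (x : H) : ℝ :=
  ∫ y, f (U t s x + y) ∂(μ t s)

/-- `(ν_t)` is an evolution system of measures for `p_{s,t}`: probability measures with
`∫ p_{s,t} f dν_s = ∫ f dν_t` for all `s ≤ t` and all bounded measurable `f`. -/
structure IsEvolutionSystem (U : ℝ → ℝ → H →L[ℝ] H) (μ : ℝ → ℝ → Measure H)
    (ν : ℝ → Measure H) : Prop where
  isProbabilityMeasure : ∀ t, IsProbabilityMeasure (ν t)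
  integral_mehler : ∀ s t, s ≤ t → ∀ f : H → ℝ, Measurable f → (∃ C, ∀ x, |f x| ≤ C) →
    ∫ x, mehler U μ s t f x ∂(ν s) = ∫ x, f x ∂(ν t)

variable [CompleteSpace H]

open Classical in
/-- `|Γ_{t,s} x| = |R_{t,s}^{-1/2} U(t,s) x|`, equal to `∞` if `U(t,s) x` is not in the range of
`R_{t,s}^{1/2}`. -/
def gammaNorm (U R : ℝ → ℝ → H →L[ℝ] H) (t s : ℝ) (x : H) : ℝ≥0∞ :=
  if U t s x ∈ (sqrtOp (R t s) : H →ₗ[ℝ] H).range then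
    ‖pseudoInverse (sqrtOp (R t s)) (U t s x)‖ₑ
  else ∞

/-- The constant
`C_{s,t}(α,ε) = ∫ [∫ exp(-α |Γ_{t,s}(x-y)|² / (2(α-1))) ν_s(dy)]^{-(1+ε)} ν_s(dx) ∈ [0, ∞]`. -/
def hyperConst (U R : ℝ → ℝ → H →L[ℝ] H) (ν : ℝ → Measure H) (s t α ε : ℝ) : ℝ≥0∞ :=
  ∫⁻ x, (∫⁻ y, EReal.exp
      (-((ENNReal.ofReal (α / (2 * (α - 1))) * gammaNorm U R t s (x - y) ^ 2 : ℝ≥0∞) : EReal))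
    ∂(ν s)) ^ (-(1 + ε)) ∂(ν s)

end Semigroup

end Mehler

end

/-! The estimate is Wang's Harnack inequality integrated against `ν s`. For `F ≥ 0`, `harnack`
bounds `(p_{s,t}F(x))^α · exp(-α|Γ(x-y)|²/(2(α-1)))` by `p_{s,t}(F^α)(y)`. Integrating in `y` over
`ν s` turns the right side into `∫ F^α dν_t` by invariance. Dividing by the integrated exponential,
raising to the power `1 + ε` and integrating in `x` produces `hyperConst`.

The Harnack inequality is a shift inequality for `μ t s` along `R^{1/2}u`
(`HasLevyTriplet.lintegral_add_sqrtOp_le`). In dimension one it is Hölder's inequality against the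
Cameron-Martin density. Its constant depends only on the size of the shift, so it survives
convolution with any probability measure (Jensen) and weak limits. If `h ⊗ h ≤ R`, the Gaussian part
splits off an independent one-dimensional Gaussian along `h`; the remaining covariance, the drift
and the jumps are absorbed into the other factor.

The splitting is done on characteristic functions of finite-dimensional projections. The jump part
is a limit of shifted compound Poisson laws, and Lévy's continuity theorem gives weak convergence.
Cylindrical functions then yield bounded continuous ones by strong convergence of projections, and
measurable ones by density in `L^α`. -/

open Filter Topology ProbabilityTheory
open scoped NNReal BoundedContinuousFunction

namespace Mehler

/-! ### Cameron-Martin shifts in dimension one -/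

section GaussianShift

/-- The `q`-th moment of the Cameron-Martin density of the standard normal law. -/
lemma lintegral_rpow_exp_gaussianReal (c q : ℝ) :
    ∫⁻ z, ENNReal.ofReal (Real.exp (c * z - c ^ 2 / 2)) ^ q ∂(gaussianReal 0 1)
      = ENNReal.ofReal (Real.exp (q * (q - 1) * c ^ 2 / 2)) := by
  have e : ∀ z : ℝ, ENNReal.ofReal (Real.exp (c * z - c ^ 2 / 2)) ^ q
      = ENNReal.ofReal (Real.exp (-(q * c ^ 2 / 2)) * Real.exp (q * c * z)) := fun z => by
    rw [ENNReal.ofReal_rpow_of_pos (Real.exp_pos _), ← Real.exp_mul, ← Real.exp_add]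
    congr 2; ring
  simp_rw [e]
  rw [← ofReal_integral_eq_lintegral_ofReal
    ((integrable_exp_mul_gaussianReal (q * c)).const_mul _) (ae_of_all _ fun z => by positivity),
    integral_const_mul]
  have := congrFun (mgf_fun_id_gaussianReal (μ := 0) (v := 1)) (q * c)
  rw [mgf] at this
  rw [this, ← Real.exp_add]
  congr 2
  push_cast
  ring

/-- The Cameron-Martin formula in dimension one. -/
lemma lintegral_gaussianReal_add (c : ℝ) {φ : ℝ → ℝ≥0∞} (hφ : Measurable φ) :
    ∫⁻ z, φ (z + c) ∂(gaussianReal 0 1)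
      = ∫⁻ z, φ z * ENNReal.ofReal (Real.exp (c * z - c ^ 2 / 2)) ∂(gaussianReal 0 1) := by
  have := gaussianReal_map_add_const (μ := 0) (v := 1) c
  rw [← lintegral_map (f := φ) (g := fun z => z + c) hφ (by fun_prop), this, gaussianReal_of_var_ne_zero _ one_ne_zero, gaussianReal_of_var_ne_zero _ one_ne_zero,
    lintegral_withDensity_eq_lintegral_mul _ (measurable_gaussianPDF _ _) hφ,
    lintegral_withDensity_eq_lintegral_mul (g := fun z => φ z * _) _
      (measurable_gaussianPDF _ _) (by fun_prop)]
  refine lintegral_congr fun z => ?_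
  simp only [Pi.mul_apply, gaussianPDF]
  rw [mul_left_comm, ← ENNReal.ofReal_mul (gaussianPDFReal_nonneg _ _ _), mul_comm]
  congr 2
  simp only [gaussianPDFReal, mul_assoc]
  rw [← Real.exp_add]
  congr 2
  push_cast
  ring

/-- The constant of the shift inequality. -/
noncomputable def shiftConst (α c : ℝ) : ℝ≥0∞ :=
  ENNReal.ofReal (Real.exp (c ^ 2 / (2 * (α - 1))))

/-- Hölder against the Cameron-Martin density with conjugate exponent `q = α/(α-1)`: its `L^q` norm
is `exp((q-1)c²/2)`, and `q - 1 = 1/(α-1)`. -/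
lemma lintegral_gaussianReal_add_le {α : ℝ} (hα : 1 < α) (c : ℝ) {φ : ℝ → ℝ≥0∞}
    (hφ : Measurable φ) :
    ∫⁻ z, φ (z + c) ∂(gaussianReal 0 1)
      ≤ shiftConst α c * (∫⁻ z, φ z ^ α ∂(gaussianReal 0 1)) ^ (1 / α) := by
  have hq := Real.HolderConjugate.conjExponent hα
  rw [lintegral_gaussianReal_add c hφ, mul_comm]
  refine (ENNReal.lintegral_mul_le_Lp_mul_Lq _ hq hφ.aemeasurable
    (by fun_prop : Measurable _).aemeasurable).trans ?_
  refine mul_le_mul_right ?_ _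
  rw [lintegral_rpow_exp_gaussianReal, shiftConst, ENNReal.ofReal_rpow_of_pos (Real.exp_pos _),
    ← Real.exp_mul]
  refine le_of_eq ?_
  congr 2
  have h1 : α - 1 ≠ 0 := by linarith
  have h0 : α ≠ 0 := by linarith
  rw [Real.conjExponent]
  field_simp
  ring

end GaussianShift

/-! ### Shift inequalities under convolution and weak limits -/

section Conv

variable {E : Type*} [NormedAddCommGroup E] [InnerProductSpace ℝ E] [MeasurableSpace E]
  [BorelSpace E] [SecondCountableTopology E]

lemma lintegral_le_rpow_lintegral_rpow {X : Type*} [MeasurableSpace X] {κ : Measure X}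
    [IsProbabilityMeasure κ] {α : ℝ} (hα : 1 < α) {φ : X → ℝ≥0∞} (hφ : AEMeasurable φ κ) :
    ∫⁻ x, φ x ∂κ ≤ (∫⁻ x, φ x ^ α ∂κ) ^ (1 / α) := by
  have hq := Real.HolderConjugate.conjExponent hα
  have := ENNReal.lintegral_mul_le_Lp_mul_Lq κ hq hφ (aemeasurable_const (b := 1))
  simpa using this

/-- Shift inequality for a law with a Gaussian component in direction `k`. -/
lemma lintegral_conv_gaussian_add_le {α : ℝ} (hα : 1 < α) (κ : Measure E)
    [IsProbabilityMeasure κ] (k : E) (c : ℝ) {F : E → ℝ≥0∞} (hF : Measurable F) :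
    ∫⁻ x, F (x + c • k) ∂(κ ∗ (gaussianReal 0 1).map (fun z => z • k))
      ≤ shiftConst α c *
        (∫⁻ x, F x ^ α ∂(κ ∗ (gaussianReal 0 1).map (fun z => z • k))) ^ (1 / α) := by
  have hk : Measurable fun z : ℝ => z • k := by fun_prop
  have hpr : IsProbabilityMeasure ((gaussianReal 0 1).map (fun z => z • k)) :=
    Measure.isProbabilityMeasure_map hk.aemeasurable
  rw [Measure.lintegral_conv (by fun_prop), Measure.lintegral_conv (by fun_prop)]
  have e1 : ∀ x, ∫⁻ y, F (x + y + c • k) ∂((gaussianReal 0 1).map (fun z => z • k))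
      = ∫⁻ z, F (x + (z + c) • k) ∂(gaussianReal 0 1) := fun x => by
    rw [lintegral_map (by fun_prop) hk]
    simp only [add_smul, add_assoc]
  have e2 : ∀ x, ∫⁻ y, F (x + y) ^ α ∂((gaussianReal 0 1).map (fun z => z • k))
      = ∫⁻ z, F (x + z • k) ^ α ∂(gaussianReal 0 1) := fun x => by
    rw [lintegral_map (by fun_prop) hk]
  simp_rw [e1, e2]
  have hm : Measurable fun x => ∫⁻ z, F (x + z • k) ^ α ∂(gaussianReal 0 1) :=
    Measurable.lintegral_prod_right' (f := fun p : E × ℝ => F (p.1 + p.2 • k) ^ α) (by fun_prop)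
  calc ∫⁻ x, ∫⁻ z, F (x + (z + c) • k) ∂(gaussianReal 0 1) ∂κ
      ≤ ∫⁻ x, shiftConst α c * (∫⁻ z, F (x + z • k) ^ α ∂(gaussianReal 0 1)) ^ (1 / α) ∂κ :=
        lintegral_mono fun x => lintegral_gaussianReal_add_le hα c
          (φ := fun z => F (x + z • k)) (by fun_prop)
    _ = shiftConst α c * ∫⁻ x, (∫⁻ z, F (x + z • k) ^ α ∂(gaussianReal 0 1)) ^ (1 / α) ∂κ :=
        lintegral_const_mul _ (by fun_prop)
    -- Jensen for the probability measure `κ`: averaging adds no constant, so the bound is uniform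
    -- in `κ`.
    _ ≤ _ := by
        refine mul_le_mul_right ?_ _
        refine (lintegral_le_rpow_lintegral_rpow hα (by fun_prop)).trans_eq ?_
        congr 1
        refine lintegral_congr fun x => ?_
        rw [← ENNReal.rpow_mul, one_div, inv_mul_cancel₀ (by linarith), ENNReal.rpow_one]

lemma charFun_map_smul_gaussianReal (k ξ : E) :
    charFun ((gaussianReal 0 1).map (fun z : ℝ => z • k)) ξ
      = Complex.exp (-((⟪k, ξ⟫_ℝ : ℂ) ^ 2 / 2)) := by
  rw [charFun_apply, integral_map (by fun_prop) (by fun_prop)]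
  have := charFun_gaussianReal (μ := 0) (v := 1) ⟪k, ξ⟫_ℝ
  rw [charFun_apply_real] at this
  simp only [real_inner_smul_left]
  refine Eq.trans ?_ (this.trans ?_)
  · refine integral_congr_ae (ae_of_all _ fun z => ?_)
    simp only
    congr 2
    push_cast
    ring
  · congr 1
    push_cast
    ring

/-- Shift inequality for weak limits of laws with a Gaussian component in direction `k`. -/
lemma lintegral_add_le_of_tendsto_charFun [FiniteDimensional ℝ E] {α : ℝ} (hα : 1 < α)
    (κ : ℕ → Measure E) [∀ n, IsProbabilityMeasure (κ n)] (ρ : Measure E) [IsProbabilityMeasure ρ]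
    (k : E) (hκ : ∀ ξ, Tendsto (fun n => charFun (κ n) ξ *
      Complex.exp (-((⟪k, ξ⟫_ℝ : ℂ) ^ 2 / 2))) atTop (𝓝 (charFun ρ ξ)))
    (c : ℝ) (g : E →ᵇ ℝ≥0) :
    ∫⁻ x, g (x + c • k) ∂ρ ≤ shiftConst α c * (∫⁻ x, (g x : ℝ≥0∞) ^ α ∂ρ) ^ (1 / α) := by
  have hk : Measurable fun z : ℝ => z • k := by fun_prop
  have hpr : IsProbabilityMeasure ((gaussianReal 0 1).map (fun z => z • k)) :=
    Measure.isProbabilityMeasure_map hk.aemeasurable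
  let θ : ℕ → ProbabilityMeasure E := fun n =>
    ⟨κ n ∗ (gaussianReal 0 1).map (fun z => z • k), inferInstance⟩
  let ρ' : ProbabilityMeasure E := ⟨ρ, inferInstance⟩
  have hθ : Tendsto θ atTop (𝓝 ρ') := by
    refine ProbabilityMeasure.tendsto_of_tendsto_charFun fun ξ => ?_
    refine (hκ ξ).congr fun n => ?_
    simp only [θ, ProbabilityMeasure.coe_mk, charFun_conv, charFun_map_smul_gaussianReal]
  replace hθ := ProbabilityMeasure.tendsto_iff_forall_lintegral_tendsto.1 hθ
  have hα0 : 0 ≤ α := by linarith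
  obtain ⟨C, hC⟩ : ∃ C : ℝ≥0, ∀ x, g x ≤ C := ⟨_, fun x => g.apply_le_nndist_zero x⟩
  let g1 : E →ᵇ ℝ≥0 := g.compContinuous ⟨fun x => x + c • k, by fun_prop⟩
  -- The power `g ^ α` has to be a bounded continuous test function too, since both sides pass to
  -- the weak limit.
  let g2 : E →ᵇ ℝ≥0 := BoundedContinuousFunction.mkOfBound
    ⟨fun x => g x ^ α, by
      exact (NNReal.continuous_rpow_const hα0).comp g.continuous⟩ (C ^ α) fun x y => by
      rw [NNReal.dist_eq]
      have h1 := NNReal.rpow_le_rpow (hC x) hα0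
      have h2 := NNReal.rpow_le_rpow (hC y) hα0
      have h1' : ((g x ^ α : ℝ≥0) : ℝ) ≤ ((C ^ α : ℝ≥0) : ℝ) := by exact_mod_cast h1
      have h2' : ((g y ^ α : ℝ≥0) : ℝ) ≤ ((C ^ α : ℝ≥0) : ℝ) := by exact_mod_cast h2
      have := (g x ^ α).coe_nonneg
      have := (g y ^ α).coe_nonneg
      simp only [ContinuousMap.coe_mk]
      rw [← NNReal.coe_rpow]
      exact abs_sub_le_iff.2 ⟨by linarith, by linarith⟩
  have e2 : ∀ x, (g2 x : ℝ≥0∞) = (g x : ℝ≥0∞) ^ α := fun x => by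
    rw [← ENNReal.coe_rpow_of_nonneg _ hα0]; rfl
  have l1 := hθ g1
  have l2 := hθ g2
  simp only [e2] at l2
  have l3 := ENNReal.Tendsto.const_mul (a := shiftConst α c)
    ((ENNReal.continuous_rpow_const (y := 1 / α)).tendsto _ |>.comp l2)
    (Or.inr ENNReal.ofReal_ne_top)
  refine le_of_tendsto_of_tendsto' l1 l3 fun n => ?_
  exact lintegral_conv_gaussian_add_le hα (κ n) k c
    (F := fun x => (g x : ℝ≥0∞)) (by exact (g.continuous.measurable).coe_nnreal_ennreal)

end Conv

/-! ### Compound Poisson laws -/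

section CompoundPoisson

variable {E : Type*} [NormedAddCommGroup E] [InnerProductSpace ℝ E] [MeasurableSpace E]
  [BorelSpace E] [SecondCountableTopology E]

/-- Convolution powers of a measure. -/
noncomputable def convPow (κ : Measure E) : ℕ → Measure E
  | 0 => Measure.dirac 0
  | n + 1 => convPow κ n ∗ κ

omit [InnerProductSpace ℝ E] [BorelSpace E] [SecondCountableTopology E] in
lemma isFiniteMeasure_convPow (κ : Measure E) [IsFiniteMeasure κ] (n : ℕ) :
    IsFiniteMeasure (convPow κ n) := by
  induction n with
  | zero => rw [convPow]; infer_instance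
  | succ n ih => rw [convPow]; infer_instance

lemma charFun_convPow (κ : Measure E) [IsFiniteMeasure κ] (n : ℕ) (ξ : E) :
    charFun (convPow κ n) ξ = charFun κ ξ ^ n := by
  induction n with
  | zero => simp [convPow]
  | succ n ih =>
    have := isFiniteMeasure_convPow κ n
    rw [convPow, charFun_conv, ih, pow_succ]

/-- The compound Poisson law `e^{-κ(E)} ∑ κ^{*n} / n!`. -/
noncomputable def compoundPoisson (κ : Measure E) : Measure E :=
  Measure.sum fun n : ℕ =>
    ENNReal.ofReal (Real.exp (-κ.real Set.univ) * (n.factorial : ℝ)⁻¹) • convPow κ n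

omit [InnerProductSpace ℝ E] in
lemma convPow_univ (κ : Measure E) [IsFiniteMeasure κ] (n : ℕ) :
    convPow κ n Set.univ = κ Set.univ ^ n := by
  induction n with
  | zero => simp [convPow]
  | succ n ih =>
    have := isFiniteMeasure_convPow κ n
    rw [convPow, Measure.conv, Measure.map_apply (by fun_prop) MeasurableSet.univ,
      Set.preimage_univ, ← Set.univ_prod_univ, Measure.prod_prod, ih, pow_succ]

instance isProbabilityMeasure_compoundPoisson (κ : Measure E) [IsFiniteMeasure κ] :
    IsProbabilityMeasure (compoundPoisson κ) := by
  refine ⟨?_⟩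
  rw [compoundPoisson, Measure.sum_apply _ MeasurableSet.univ]
  have e : ∀ n : ℕ, (ENNReal.ofReal (Real.exp (-κ.real Set.univ) * (n.factorial : ℝ)⁻¹) •
      convPow κ n) Set.univ = ENNReal.ofReal (Real.exp (-κ.real Set.univ) *
        ((κ.real Set.univ) ^ n / n.factorial)) := fun n => by
    rw [Measure.smul_apply, smul_eq_mul, convPow_univ, ← ofReal_measureReal,
      ← ENNReal.ofReal_pow (by positivity), ← ENNReal.ofReal_mul (by positivity)]
    congr 1
    ring
  simp_rw [e]
  have hs := (NormedSpace.expSeries_div_hasSum_exp (κ.real Set.univ)).mul_left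
    (Real.exp (-κ.real Set.univ))
  rw [← ENNReal.ofReal_tsum_of_nonneg (fun n => by positivity) hs.summable, hs.tsum_eq,
    ← Real.exp_eq_exp_ℝ, ← Real.exp_add]
  simp

/-- Convolution powers become powers of `charFun κ ξ`, so integrating termwise sums an exponential
series. -/
lemma charFun_compoundPoisson (κ : Measure E) [IsFiniteMeasure κ] (ξ : E) :
    charFun (compoundPoisson κ) ξ = Complex.exp (charFun κ ξ - κ.real Set.univ) := by
  have hint : Integrable (fun x => Complex.exp (⟪x, ξ⟫_ℝ * Complex.I)) (compoundPoisson κ) := by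
    refine (integrable_const (1 : ℝ)).mono' (by fun_prop) (ae_of_all _ fun x => ?_)
    rw [Complex.norm_exp_ofReal_mul_I]
  have h := hasSum_integral_measure hint
  rw [charFun_apply, compoundPoisson, ← h.tsum_eq]
  have hs := (NormedSpace.expSeries_div_hasSum_exp (charFun κ ξ)).mul_left
    (Complex.exp (-κ.real Set.univ))
  rw [← Complex.exp_eq_exp_ℂ, ← Complex.exp_add] at hs
  rw [sub_eq_neg_add, ← hs.tsum_eq]
  refine tsum_congr fun n => ?_
  rw [integral_smul_measure, ENNReal.toReal_ofReal (by positivity), ← charFun_apply,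
    charFun_convPow, Complex.real_smul]
  push_cast
  ring

end CompoundPoisson

/-! ### Integrability of the Lévy-Khintchine kernel -/

section Levy

variable {H : Type*} [NormedAddCommGroup H] [InnerProductSpace ℝ H]

/-- The integrand of the Lévy-Khintchine formula. -/
noncomputable def levyKernel (ξ x : H) : ℂ :=
  Complex.exp (Complex.I * (⟪ξ, x⟫_ℝ : ℂ)) - 1
    - Complex.I * (⟪ξ, x⟫_ℝ : ℂ) / ((1 + ‖x‖ ^ 2 : ℝ) : ℂ)

lemma norm_exp_I_mul_sub_le (θ : ℝ) :
    ‖Complex.exp (Complex.I * θ) - 1 - Complex.I * θ‖ ≤ 3 * θ ^ 2 := by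
  have hn : ‖Complex.I * (θ : ℂ)‖ = |θ| := by simp
  by_cases h : |θ| ≤ 1
  · refine (Complex.norm_exp_sub_one_sub_id_le (hn.trans_le h)).trans ?_
    rw [hn, sq_abs]
    nlinarith [sq_nonneg θ]
  · push Not at h
    have h1 : ‖Complex.exp (Complex.I * θ)‖ = 1 := Complex.norm_exp_I_mul_ofReal θ
    have h2 := norm_sub_le (Complex.exp (Complex.I * θ) - 1) (Complex.I * θ)
    have h3 := norm_sub_le (Complex.exp (Complex.I * θ)) 1
    rw [h1, norm_one] at h3
    rw [hn] at h2
    nlinarith [sq_abs θ]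

/-- For `‖x‖ ≤ 1` the kernel is a second-order Taylor remainder plus `iθ‖x‖²/(1+‖x‖²)`, both of
order `‖x‖²`; for `‖x‖ ≥ 1` each of its terms is bounded. -/
lemma norm_levyKernel_le (ξ x : H) :
    ‖levyKernel ξ x‖ ≤ (2 + ‖ξ‖ + 3 * ‖ξ‖ ^ 2) * min 1 (‖x‖ ^ 2) := by
  have hθ : |⟪ξ, x⟫_ℝ| ≤ ‖ξ‖ * ‖x‖ := abs_real_inner_le_norm ξ x
  set θ := ⟪ξ, x⟫_ℝ
  have hp : 0 < 1 + ‖x‖ ^ 2 := by positivity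
  have hξ := norm_nonneg ξ
  have hx := norm_nonneg x
  rcases le_total ‖x‖ 1 with h | h
  · have hmin : min 1 (‖x‖ ^ 2) = ‖x‖ ^ 2 := min_eq_right (by nlinarith)
    have e : levyKernel ξ x = (Complex.exp (Complex.I * θ) - 1 - Complex.I * θ)
        + Complex.I * ((θ * (‖x‖ ^ 2 / (1 + ‖x‖ ^ 2)) : ℝ) : ℂ) := by
      have : ((1 + ‖x‖ ^ 2 : ℝ) : ℂ) ≠ 0 := by exact_mod_cast hp.ne'
      rw [levyKernel]
      push_cast at this ⊢
      field_simp
      ring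
    rw [e, hmin]
    refine (norm_add_le _ _).trans ?_
    have h1 := norm_exp_I_mul_sub_le θ
    have h2 : θ ^ 2 ≤ ‖ξ‖ ^ 2 * ‖x‖ ^ 2 := by
      rw [← sq_abs, ← mul_pow]
      gcongr
    have h3 : ‖Complex.I * ((θ * (‖x‖ ^ 2 / (1 + ‖x‖ ^ 2)) : ℝ) : ℂ)‖ ≤ ‖ξ‖ * ‖x‖ ^ 2 := by
      rw [norm_mul, Complex.norm_I, one_mul, Complex.norm_real, Real.norm_eq_abs, abs_mul,
        abs_of_nonneg (a := ‖x‖ ^ 2 / _) (by positivity)]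
      have h4 : ‖x‖ ^ 2 / (1 + ‖x‖ ^ 2) ≤ ‖x‖ ^ 2 := div_le_self (by positivity) (by nlinarith)
      have h5 : |θ| ≤ ‖ξ‖ := hθ.trans (by nlinarith)
      gcongr
    nlinarith [mul_nonneg hξ (sq_nonneg ‖x‖), sq_nonneg ‖x‖]
  · have hmin : min 1 (‖x‖ ^ 2) = 1 := min_eq_left (by nlinarith)
    rw [hmin, levyKernel]
    have h1 : ‖Complex.exp (Complex.I * θ)‖ = 1 := Complex.norm_exp_I_mul_ofReal θ
    have h2 := norm_sub_le (Complex.exp (Complex.I * θ) - 1)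
      (Complex.I * θ / ((1 + ‖x‖ ^ 2 : ℝ) : ℂ))
    have h3 := norm_sub_le (Complex.exp (Complex.I * θ)) 1
    rw [h1, norm_one] at h3
    have h4 : ‖Complex.I * θ / ((1 + ‖x‖ ^ 2 : ℝ) : ℂ)‖ ≤ ‖ξ‖ := by
      rw [norm_div, norm_mul, Complex.norm_I, one_mul, Complex.norm_real, Complex.norm_real,
        Real.norm_eq_abs, Real.norm_of_nonneg hp.le, div_le_iff₀ hp]
      refine hθ.trans (mul_le_mul_of_nonneg_left ?_ hξ)
      nlinarith
    have : θ = ⟪ξ, x⟫_ℝ := rfl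
    rw [← this]
    nlinarith [sq_nonneg ‖ξ‖]

variable [MeasurableSpace H] [BorelSpace H]

omit [InnerProductSpace ℝ H] in
lemma IsLevyMeasure.integrable_min {m : Measure H} (hm : IsLevyMeasure m) :
    Integrable (fun x => min 1 (‖x‖ ^ 2)) m := by
  refine ⟨Continuous.aestronglyMeasurable (by fun_prop), ?_⟩
  refine lt_of_eq_of_lt (lintegral_congr fun x => ?_) hm.lintegral_lt_top
  rw [Real.enorm_of_nonneg (by positivity), ENNReal.ofReal_min, ENNReal.ofReal_one,
    ENNReal.ofReal_pow (norm_nonneg x), ofReal_norm]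

end Levy

/-! ### Compound Poisson approximation of the jump part -/

section Levy2

variable {H : Type*} [NormedAddCommGroup H] [InnerProductSpace ℝ H]
  [MeasurableSpace H] [BorelSpace H] [SecondCountableTopology H]

lemma IsLevyMeasure.integrable_levyKernel {m : Measure H} (hm : IsLevyMeasure m) (ξ : H) :
    Integrable (levyKernel ξ) m := by
  refine (hm.integrable_min.const_mul (2 + ‖ξ‖ + 3 * ‖ξ‖ ^ 2)).mono' ?_
    (ae_of_all _ (norm_levyKernel_le ξ))
  unfold levyKernel
  exact Measurable.aestronglyMeasurable (by fun_prop)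

/-- The restriction of a Lévy measure to the jumps of size at least `1/(n+1)`. -/
noncomputable def levyTrunc (m : Measure H) (n : ℕ) : Measure H :=
  m.restrict {x | 1 / ((n : ℝ) + 1) < ‖x‖}

omit [InnerProductSpace ℝ H] [SecondCountableTopology H] in
lemma IsLevyMeasure.isFiniteMeasure_levyTrunc {m : Measure H} (hm : IsLevyMeasure m) (n : ℕ) :
    IsFiniteMeasure (levyTrunc m n) := by
  refine ⟨?_⟩
  rw [levyTrunc, Measure.restrict_apply_univ]
  have hδ : (0 : ℝ) < 1 / ((n : ℝ) + 1) := by positivity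
  have h1 : 1 / ((n : ℝ) + 1) ≤ 1 := by
    rw [div_le_one (by positivity)]
    linarith [n.cast_nonneg (α := ℝ)]
  refine (measure_mono fun x hx => ?_).trans_lt
    (hm.integrable_min.measure_ge_lt_top (ε := (1 / ((n : ℝ) + 1)) ^ 2) (by positivity))
  have hx' : 1 / ((n : ℝ) + 1) < ‖x‖ := hx
  exact le_min (pow_le_one₀ hδ.le h1) (by gcongr)

/-- Dominated convergence: the truncation sets exhaust the complement of `0`, and the kernel
vanishes at `0`. -/
lemma IsLevyMeasure.tendsto_integral_levyTrunc {m : Measure H} (hm : IsLevyMeasure m) (ξ : H) :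
    Tendsto (fun n => ∫ x, levyKernel ξ x ∂(levyTrunc m n)) atTop
      (𝓝 (∫ x, levyKernel ξ x ∂m)) := by
  have hS : ∀ n : ℕ, MeasurableSet {x : H | 1 / ((n : ℝ) + 1) < ‖x‖} := fun n =>
    measurableSet_lt measurable_const measurable_norm
  simp only [levyTrunc, ← integral_indicator (hS _)]
  refine tendsto_integral_of_dominated_convergence (fun x => ‖levyKernel ξ x‖)
    (fun n => (hm.integrable_levyKernel ξ).aestronglyMeasurable.indicator (hS n))
    (hm.integrable_levyKernel ξ).norm (fun n => ae_of_all _ fun x => norm_indicator_le_norm_self _ _)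
    (ae_of_all _ fun x => ?_)
  by_cases hx : x = 0
  · have : levyKernel ξ x = 0 := by simp [hx, levyKernel]
    refine tendsto_const_nhds.congr fun n => ?_
    rw [this, Set.indicator_apply]
    split_ifs <;> simp [this]
  · refine tendsto_const_nhds.congr' ?_
    filter_upwards [(tendsto_one_div_add_atTop_nhds_zero_nat (𝕜 := ℝ)).eventually
      (gt_mem_nhds (norm_pos_iff.2 hx))] with n hn
    rw [Set.indicator_of_mem]
    exact hn

/-- The compensator `∫ x / (1 + |x|²) κ(dx)`. -/
noncomputable def levyDrift (κ : Measure H) : H := ∫ x, (1 + ‖x‖ ^ 2)⁻¹ • x ∂κ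

variable [CompleteSpace H]

/-- For finite `κ` the three terms of the kernel are separately integrable. The result is the
compound Poisson exponent minus a drift, which explains the Dirac mass in `levyApprox`. -/
lemma integral_levyKernel_of_isFiniteMeasure (κ : Measure H) [IsFiniteMeasure κ] (ξ : H) :
    ∫ x, levyKernel ξ x ∂κ
      = charFun κ ξ - κ.real Set.univ - Complex.I * (⟪levyDrift κ, ξ⟫_ℝ : ℂ) := by
  have hb : Integrable (fun x : H => (1 + ‖x‖ ^ 2)⁻¹ • x) κ := by
    refine (integrable_const (1 : ℝ)).mono' (Measurable.aestronglyMeasurable (by fun_prop))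
      (ae_of_all _ fun x => ?_)
    have hp : 0 < 1 + ‖x‖ ^ 2 := by positivity
    rw [norm_smul, norm_inv, Real.norm_of_nonneg hp.le, inv_mul_le_iff₀ hp]
    nlinarith [sq_nonneg (‖x‖ - 1)]
  have hexp : Integrable (fun x => Complex.exp (⟪x, ξ⟫_ℝ * Complex.I)) κ := by
    refine (integrable_const (1 : ℝ)).mono' (by fun_prop) (ae_of_all _ fun x => ?_)
    rw [Complex.norm_exp_ofReal_mul_I]
  have e : ∀ x, levyKernel ξ x = Complex.exp (⟪x, ξ⟫_ℝ * Complex.I) - 1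
      - Complex.I * ((⟪ξ, (1 + ‖x‖ ^ 2)⁻¹ • x⟫_ℝ : ℝ) : ℂ) := fun x => by
    rw [levyKernel, inner_smul_right, real_inner_comm x ξ, mul_comm Complex.I]
    push_cast
    ring
  have hin : Integrable (fun x => ((⟪ξ, (1 + ‖x‖ ^ 2)⁻¹ • x⟫_ℝ : ℝ) : ℂ)) κ :=
    (hb.const_inner ξ).ofReal
  have hexp1 : Integrable (fun x => Complex.exp (⟪x, ξ⟫_ℝ * Complex.I) - 1) κ :=
    hexp.sub (integrable_const _)
  simp_rw [e]
  rw [integral_sub hexp1 (hin.const_mul _),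
    integral_sub hexp (integrable_const _), integral_const_mul, integral_complex_ofReal,
    integral_inner hb, ← charFun_apply, real_inner_comm, levyDrift]
  simp

/-- Approximation of the law `D[a, 0, m]` by shifted compound Poisson laws. -/
noncomputable def levyApprox (a : H) (m : Measure H) (n : ℕ) : Measure H :=
  Measure.dirac (a - levyDrift (levyTrunc m n)) ∗ compoundPoisson (levyTrunc m n)

omit [CompleteSpace H] in
lemma IsLevyMeasure.isProbabilityMeasure_levyApprox {m : Measure H} (hm : IsLevyMeasure m) (a : H)
    (n : ℕ) : IsProbabilityMeasure (levyApprox a m n) := by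
  have := hm.isFiniteMeasure_levyTrunc n
  rw [levyApprox]
  infer_instance

lemma IsLevyMeasure.tendsto_charFun_levyApprox {m : Measure H} (hm : IsLevyMeasure m) (a ξ : H) :
    Tendsto (fun n => charFun (levyApprox a m n) ξ) atTop
      (𝓝 (Complex.exp (Complex.I * (⟪a, ξ⟫_ℝ : ℂ) + ∫ x, levyKernel ξ x ∂m))) := by
  refine ((Complex.continuous_exp.tendsto _).comp
    ((hm.tendsto_integral_levyTrunc ξ).const_add (Complex.I * (⟪a, ξ⟫_ℝ : ℂ)))).congr fun n => ?_
  have := hm.isFiniteMeasure_levyTrunc n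
  rw [levyApprox, charFun_conv, charFun_dirac, charFun_compoundPoisson, ← Complex.exp_add,
    Function.comp_apply, integral_levyKernel_of_isFiniteMeasure, inner_sub_left]
  congr 1
  push_cast
  ring

end Levy2

/-! ### Finite-dimensional Gaussian laws -/

section Gaussian

variable {E : Type*} [NormedAddCommGroup E] [InnerProductSpace ℝ E] [FiniteDimensional ℝ E]
  [MeasurableSpace E] [BorelSpace E]

lemma inner_sqrtOp_self {H : Type*} [NormedAddCommGroup H] [InnerProductSpace ℝ H]
    [CompleteSpace H] {R : H →L[ℝ] H} (hR : R.IsPositive) (ξ : H) :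
    ‖sqrtOp R ξ‖ ^ 2 = ⟪ξ, R ξ⟫_ℝ := by
  obtain ⟨hS, hSS⟩ := sqrtOp_spec hR
  have h : R ξ = sqrtOp R (sqrtOp R ξ) := by
    conv_lhs => rw [← hSS]
    rfl
  rw [h, ← real_inner_self_eq_norm_sq]
  exact hS.inner_left_eq_inner_right _ _

/-- Centred Gaussian laws with prescribed covariance on a finite-dimensional space. -/
lemma exists_charFun_eq_exp_neg {Q : E →L[ℝ] E} (hQ : Q.IsPositive) :
    ∃ γ : Measure E, IsProbabilityMeasure γ ∧
      ∀ ξ, charFun γ ξ = Complex.exp (-((⟪ξ, Q ξ⟫_ℝ : ℂ) / 2)) := by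
  have : CompleteSpace E := FiniteDimensional.complete ℝ E
  refine ⟨(stdGaussian E).map (sqrtOp Q), Measure.isProbabilityMeasure_map (by fun_prop),
    fun ξ => ?_⟩
  have h1 : charFun ((stdGaussian E).map (sqrtOp Q)) ξ
      = charFun (stdGaussian E) (sqrtOp Q ξ) := by
    rw [charFun_apply, charFun_apply, integral_map (by fun_prop) (by fun_prop)]
    refine integral_congr_ae (ae_of_all _ fun x => ?_)
    simp only
    rw [(sqrtOp_spec hQ).1.inner_left_eq_inner_right x ξ]
  rw [h1, charFun_stdGaussian, ← inner_sqrtOp_self hQ]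
  congr 1
  push_cast
  ring

end Gaussian

/-! ### From cylindrical to bounded continuous functions -/

section Cylinder

variable {H : Type*} [NormedAddCommGroup H] [InnerProductSpace ℝ H]
  [MeasurableSpace H] [BorelSpace H]

lemma charFun_map_orthogonalProjectionOnto (μ : Measure H) (V : Submodule ℝ H)
    [V.HasOrthogonalProjection] (ξ : V) :
    charFun (μ.map V.orthogonalProjectionOnto) ξ = charFun μ (ξ : H) := by
  rw [charFun_apply, charFun_apply, integral_map (by fun_prop) (by fun_prop)]
  refine integral_congr_ae (ae_of_all _ fun x => ?_)
  simp only
  rw [Submodule.inner_orthogonalProjectionOnto_eq_of_mem_right]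

variable [CompleteSpace H] [SecondCountableTopology H]

/-- Shift inequality for cylindrical functions, along a direction `h` dominated by the
covariance. -/
lemma HasLevyTriplet.lintegral_cylinder_add_le {μ : Measure H} {a : H} {R : H →L[ℝ] H}
    {m : Measure H} (hμ : HasLevyTriplet μ a R m) {α : ℝ} (hα : 1 < α) {h : H}
    (hh : ∀ ξ, ⟪h, ξ⟫_ℝ ^ 2 ≤ ⟪ξ, R ξ⟫_ℝ) (c : ℝ) (V : Submodule ℝ H) [FiniteDimensional ℝ V]
    (g : V →ᵇ ℝ≥0) :
    ∫⁻ x, g (V.orthogonalProjectionOnto (x + c • h)) ∂μ ≤ shiftConst α c *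
      (∫⁻ x, (g (V.orthogonalProjectionOnto x) : ℝ≥0∞) ^ α ∂μ) ^ (1 / α) := by
  have hprob := hμ.isProbabilityMeasure
  let P : H →L[ℝ] V := V.orthogonalProjectionOnto
  have hP : P = V.orthogonalProjectionOnto := rfl
  have hRs : ∀ x y, ⟪R x, y⟫_ℝ = ⟪x, R y⟫_ℝ := hμ.posTraceClass.1.inner_left_eq_inner_right
  -- The covariance left after removing the direction `h` is `R - h ⊗ h`, non-negative by `hh`; `Q`
  -- is its compression to `V`.
  obtain ⟨R', hR'⟩ : ∃ R' : H →L[ℝ] H, ∀ x, R' x = R x - ⟪h, x⟫_ℝ • h :=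
    ⟨R - (innerSL ℝ h).smulRight h, fun x => by simp⟩
  obtain ⟨Q, hQi⟩ : ∃ Q : V →L[ℝ] V, ∀ x y : V, ⟪Q x, y⟫_ℝ = ⟪R' (x : H), (y : H)⟫_ℝ := by
    refine ⟨V.orthogonalProjectionOnto ∘L R' ∘L V.subtypeL, fun x y => ?_⟩
    simp only [ContinuousLinearMap.comp_apply, Submodule.subtypeL_apply]
    exact Submodule.inner_orthogonalProjectionOnto_eq_of_mem_right y (R' x)
  have hQ : Q.IsPositive := by
    refine (ContinuousLinearMap.isPositive_iff _).2 ⟨fun x y => ?_, fun x => ?_⟩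
    · change ⟪Q x, y⟫_ℝ = ⟪x, Q y⟫_ℝ
      rw [real_inner_comm (Q y), hQi, hQi, hR', hR', inner_sub_left, inner_sub_left, hRs,
        real_inner_smul_left, real_inner_smul_left, real_inner_comm (x : H) (R y)]
      ring
    · rw [hQi, hR', inner_sub_left, real_inner_smul_left, hRs]
      nlinarith [hh x]
  obtain ⟨γ, hγ, hγc⟩ := exists_charFun_eq_exp_neg hQ
  have hl := fun n => hμ.levyMeasure.isProbabilityMeasure_levyApprox a n
  have hlP : ∀ n, IsProbabilityMeasure ((levyApprox a m n).map P) := fun n =>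
    Measure.isProbabilityMeasure_map (by fun_prop)
  have hρ : IsProbabilityMeasure (μ.map P) := Measure.isProbabilityMeasure_map (by fun_prop)
  have key := lintegral_add_le_of_tendsto_charFun hα
    (fun n => γ ∗ (levyApprox a m n).map P) (μ.map P) (P h) (fun ξ => ?_) c g
  · have hg : Measurable fun x => (g x : ℝ≥0∞) := g.continuous.measurable.coe_nnreal_ennreal
    rw [lintegral_map (by fun_prop) (by fun_prop), lintegral_map (by fun_prop) (by fun_prop)]
      at key
    simpa only [map_add, map_smul] using key
  · have hlim := ((hμ.levyMeasure.tendsto_charFun_levyApprox a (ξ : H)).const_mul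
      (charFun γ ξ)).mul_const (Complex.exp (-((⟪P h, ξ⟫_ℝ : ℂ) ^ 2 / 2)))
    -- On `V` one has `⟨ξ, Rξ⟩ = ⟨ξ, Qξ⟩ + ⟨Ph, ξ⟩²`, so the projected law factors into `γ`, the
    -- drift and jump part, and a Gaussian along `P h`.
    have e : charFun (μ.map P) ξ = charFun γ ξ *
        Complex.exp (Complex.I * (⟪a, (ξ : H)⟫_ℝ : ℂ) + ∫ x, levyKernel (ξ : H) x ∂m) *
        Complex.exp (-((⟪P h, ξ⟫_ℝ : ℂ) ^ 2 / 2)) := by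
      rw [hP, charFun_map_orthogonalProjectionOnto, hμ.charFun_eq, hγc, ← Complex.exp_add,
        ← Complex.exp_add, real_inner_comm, hQi, hR', inner_sub_left, real_inner_smul_left, hRs,
        Submodule.inner_orthogonalProjectionOnto_eq_of_mem_right, levySymbol]
      congr 1
      simp only [levyKernel]
      push_cast
      ring
    rw [e]
    refine hlim.congr fun n => ?_
    rw [charFun_conv, hP, charFun_map_orthogonalProjectionOnto]

/-- An increasing sequence of finite-dimensional subspaces with dense union. -/
lemma exists_monotone_finiteDimensional_dense (H : Type*) [NormedAddCommGroup H]
    [InnerProductSpace ℝ H] [SecondCountableTopology H] :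
    ∃ V : ℕ → Submodule ℝ H, Monotone V ∧ (∀ n, FiniteDimensional ℝ (V n)) ∧
      ⊤ ≤ (⨆ n, V n).topologicalClosure := by
  obtain ⟨u, hu⟩ := TopologicalSpace.exists_dense_seq H
  refine ⟨fun n => Submodule.span ℝ (u '' Set.Iic n), fun i j hij => Submodule.span_mono
    (Set.image_mono (Set.Iic_subset_Iic.2 hij)), fun n =>
    FiniteDimensional.span_of_finite ℝ ((Set.finite_Iic n).image u), fun x _ => ?_⟩
  refine closure_mono ?_ (hu x)
  rintro _ ⟨n, rfl⟩
  exact Submodule.mem_iSup_of_mem n (Submodule.subset_span ⟨n, Set.mem_Iic.2 le_rfl, rfl⟩)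

/-- Projections onto increasing subspaces with dense union converge strongly to the identity, so the
cylindrical bound, whose constant is independent of the subspace, passes to the limit. -/
lemma HasLevyTriplet.lintegral_boundedContinuous_add_le {μ : Measure H} {a : H} {R : H →L[ℝ] H}
    {m : Measure H} (hμ : HasLevyTriplet μ a R m) {α : ℝ} (hα : 1 < α) {h : H}
    (hh : ∀ ξ, ⟪h, ξ⟫_ℝ ^ 2 ≤ ⟪ξ, R ξ⟫_ℝ) (c : ℝ) (g : H →ᵇ ℝ≥0) :
    ∫⁻ x, g (x + c • h) ∂μ ≤ shiftConst α c *
      (∫⁻ x, (g x : ℝ≥0∞) ^ α ∂μ) ^ (1 / α) := by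
  have hprob := hμ.isProbabilityMeasure
  obtain ⟨V, hV, hVf, hVd⟩ := exists_monotone_finiteDimensional_dense H
  have hα0 : 0 ≤ α := by linarith
  have hproj := fun x => Submodule.starProjection_tendsto_self V hV x hVd
  obtain ⟨C, hC⟩ : ∃ C : ℝ≥0, ∀ x, g x ≤ C := ⟨_, fun x => g.apply_le_nndist_zero x⟩
  have hg : Continuous fun x => (g x : ℝ≥0∞) := ENNReal.continuous_coe.comp g.continuous
  have hgm := hg.measurable
  have key : ∀ n, ∫⁻ x, g ((V n).starProjection (x + c • h)) ∂μ ≤ shiftConst α c *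
      (∫⁻ x, (g ((V n).starProjection x) : ℝ≥0∞) ^ α ∂μ) ^ (1 / α) := fun n =>
    hμ.lintegral_cylinder_add_le hα hh c (V n) (g.compContinuous ⟨(↑), continuous_subtype_val⟩)
  have l1 : Tendsto (fun n => ∫⁻ x, (g ((V n).starProjection (x + c • h)) : ℝ≥0∞) ∂μ) atTop
      (𝓝 (∫⁻ x, g (x + c • h) ∂μ)) := by
    refine tendsto_lintegral_of_dominated_convergence (fun _ => (C : ℝ≥0∞))
      (fun n => by fun_prop) (fun n => ae_of_all _ fun x => ENNReal.coe_le_coe.2 (hC _)) (by simp)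
      (ae_of_all _ fun x => (hg.tendsto _).comp (hproj _))
  have l2 : Tendsto (fun n => ∫⁻ x, (g ((V n).starProjection x) : ℝ≥0∞) ^ α ∂μ) atTop
      (𝓝 (∫⁻ x, (g x : ℝ≥0∞) ^ α ∂μ)) := by
    refine tendsto_lintegral_of_dominated_convergence (fun _ => (C : ℝ≥0∞) ^ α)
      (fun n => by fun_prop)
      (fun n => ae_of_all _ fun x => ENNReal.rpow_le_rpow (by exact_mod_cast hC _) hα0) ?_
      (ae_of_all _ fun x => ((ENNReal.continuous_rpow_const.comp hg).tendsto _).comp (hproj _))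
    simpa using ENNReal.rpow_ne_top_of_nonneg hα0 ENNReal.coe_ne_top
  refine le_of_tendsto_of_tendsto' l1 (ENNReal.Tendsto.const_mul
    ((ENNReal.continuous_rpow_const (y := 1 / α)).tendsto _ |>.comp l2)
    (Or.inr ENNReal.ofReal_ne_top)) key

end Cylinder

/-! ### From bounded continuous to measurable functions -/

section Density

variable {X : Type*} [TopologicalSpace X] [NormalSpace X] [MeasurableSpace X] [BorelSpace X]

/-- An `L^α`-`L¹` estimate between two finite measures extends from bounded continuous functions to
bounded measurable functions. -/
lemma eLpNorm_le_of_boundedContinuous {μ ρ : Measure X} [IsFiniteMeasure μ]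
    [IsProbabilityMeasure ρ] [(μ + ρ).WeaklyRegular] {α : ℝ} (hα : 1 < α) {K : ℝ≥0∞}
    (hK : ∀ g : X →ᵇ ℝ, eLpNorm g 1 ρ ≤ K * eLpNorm g (ENNReal.ofReal α) μ) (hK' : K ≠ ∞)
    {f : X → ℝ} (hf : Measurable f) {C : ℝ} (hC : ∀ x, |f x| ≤ C) :
    eLpNorm f 1 ρ ≤ K * eLpNorm f (ENNReal.ofReal α) μ := by
  have hp1 : 1 ≤ ENNReal.ofReal α := by simpa using ENNReal.ofReal_le_ofReal hα.le
  -- Approximating in `L^α(μ + ρ)` makes one `g` close to `f` for both measures, although `ρ` need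
  -- not be absolutely continuous a priori.
  have hmem : MemLp f (ENNReal.ofReal α) (μ + ρ) :=
    MemLp.of_bound hf.aestronglyMeasurable C (ae_of_all _ hC)
  have key : ∀ δ : ℝ≥0, 0 < δ →
      eLpNorm f 1 ρ ≤ K * (eLpNorm f (ENNReal.ofReal α) μ + δ) + δ := by
    intro δ hδ
    obtain ⟨g, hgm, hKg, hg⟩ : ∃ g : X → ℝ, Measurable g ∧
        eLpNorm g 1 ρ ≤ K * eLpNorm g (ENNReal.ofReal α) μ ∧
        eLpNorm (f - g) (ENNReal.ofReal α) (μ + ρ) ≤ δ := by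
      obtain ⟨g, hg, -⟩ := hmem.exists_boundedContinuous_eLpNorm_sub_le ENNReal.ofReal_ne_top
        (ENNReal.coe_ne_zero.2 hδ.ne')
      exact ⟨g, g.continuous.measurable, hK g, hg⟩
    have h1 : eLpNorm (f - g) 1 ρ ≤ δ :=
      (eLpNorm_le_eLpNorm_of_exponent_le hp1 (hf.sub hgm).aestronglyMeasurable).trans
        ((eLpNorm_mono_measure _ (Measure.le_add_left le_rfl)).trans hg)
    have h2 : eLpNorm (g - f) (ENNReal.ofReal α) μ ≤ δ := by
      rw [eLpNorm_sub_comm]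
      exact (eLpNorm_mono_measure _ (Measure.le_add_right le_rfl)).trans hg
    have h3 : eLpNorm g (ENNReal.ofReal α) μ ≤ eLpNorm f (ENNReal.ofReal α) μ + δ := by
      have e : f + (g - f) = g := by abel
      have := (eLpNorm_add_le hf.aestronglyMeasurable (hgm.sub hf).aestronglyMeasurable hp1).trans
        (add_le_add_right h2 _)
      rwa [e] at this
    calc eLpNorm f 1 ρ = eLpNorm (g + (f - g)) 1 ρ := by congr 1; abel
      _ ≤ eLpNorm g 1 ρ + eLpNorm (f - g) 1 ρ :=
          eLpNorm_add_le hgm.aestronglyMeasurable (hf.sub hgm).aestronglyMeasurable le_rfl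
      _ ≤ K * (eLpNorm f (ENNReal.ofReal α) μ + δ) + δ :=
          add_le_add (hKg.trans (by gcongr)) h1
  have hlim : Tendsto (fun δ : ℝ≥0 => K * (eLpNorm f (ENNReal.ofReal α) μ + δ) + δ) (𝓝[>] 0)
      (𝓝 (K * (eLpNorm f (ENNReal.ofReal α) μ + (0 : ℝ≥0)) + (0 : ℝ≥0))) := by
    have hc : Tendsto (fun δ : ℝ≥0 => (δ : ℝ≥0∞)) (𝓝[>] 0) (𝓝 ((0 : ℝ≥0) : ℝ≥0∞)) :=
      (ENNReal.continuous_coe.tendsto 0).mono_left nhdsWithin_le_nhds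
    exact (ENNReal.Tendsto.const_mul (hc.const_add _) (Or.inr hK')).add hc
  have := ge_of_tendsto hlim (eventually_nhdsWithin_of_forall fun δ hδ => key δ hδ)
  simpa using this

/-- An `L^α`-`L¹` estimate between two finite measures extends from bounded continuous functions to
non-negative measurable functions. -/
lemma lintegral_le_of_boundedContinuous {μ ρ : Measure X} [IsFiniteMeasure μ]
    [IsProbabilityMeasure ρ] [(μ + ρ).WeaklyRegular] {α : ℝ} (hα : 1 < α) {K : ℝ≥0∞}
    (hK : ∀ g : X →ᵇ ℝ≥0, ∫⁻ x, g x ∂ρ ≤ K * (∫⁻ x, (g x : ℝ≥0∞) ^ α ∂μ) ^ (1 / α))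
    (hK' : K ≠ ∞) {F : X → ℝ≥0∞} (hF : Measurable F) :
    ∫⁻ x, F x ∂ρ ≤ K * (∫⁻ x, F x ^ α ∂μ) ^ (1 / α) := by
  have hα0 : 0 < α := by linarith
  have hL : ∀ u : X → ℝ, eLpNorm u (ENNReal.ofReal α) μ = (∫⁻ x, ‖u x‖ₑ ^ α ∂μ) ^ (1 / α) :=
    fun u => by
      rw [eLpNorm_eq_lintegral_rpow_enorm_toReal (by simpa using hα0) ENNReal.ofReal_ne_top,
        ENNReal.toReal_ofReal hα0.le]
  have hK2 : ∀ g : X →ᵇ ℝ, eLpNorm g 1 ρ ≤ K * eLpNorm g (ENNReal.ofReal α) μ := fun g => by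
    rw [hL, eLpNorm_one_eq_lintegral_enorm]
    exact hK g.nnnorm
  have hn : ∀ n : ℕ, ∫⁻ x, min (F x) n ∂ρ ≤ K * (∫⁻ x, F x ^ α ∂μ) ^ (1 / α) := fun n => by
    have e : ∀ x, ‖(min (F x) n).toReal‖ₑ = min (F x) n := fun x => by
      rw [Real.enorm_of_nonneg ENNReal.toReal_nonneg, ENNReal.ofReal_toReal (by simp)]
    have hb := eLpNorm_le_of_boundedContinuous hα hK2 hK' (f := fun x => (min (F x) n).toReal)
      (by fun_prop) (C := n) fun x => by
        rw [abs_of_nonneg ENNReal.toReal_nonneg]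
        exact ENNReal.toReal_le_of_le_ofReal n.cast_nonneg (by simp)
    rw [hL, eLpNorm_one_eq_lintegral_enorm] at hb
    simp only [e] at hb
    refine hb.trans ?_
    gcongr
    exact min_le_left _ _
  have hsup : ∀ x, F x = ⨆ n : ℕ, min (F x) n := fun x => by
    rw [← inf_iSup_eq, ENNReal.iSup_natCast, inf_top_eq]
  calc ∫⁻ x, F x ∂ρ = ∫⁻ x, ⨆ n : ℕ, min (F x) n ∂ρ := lintegral_congr hsup
    _ = ⨆ n : ℕ, ∫⁻ x, min (F x) n ∂ρ := lintegral_iSup (fun n => by fun_prop)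
        fun i j hij x => min_le_min_left _ (by exact_mod_cast hij)
    _ ≤ _ := iSup_le hn

end Density

/-! ### Shifts along the range of `R^{1/2}` -/

section Shift

variable {H : Type*} [NormedAddCommGroup H] [InnerProductSpace ℝ H]
  [MeasurableSpace H] [BorelSpace H] [CompleteSpace H] [SecondCountableTopology H]

/-- Shift inequality for infinitely divisible laws along the range of `R^{1/2}`. -/
theorem HasLevyTriplet.lintegral_add_sqrtOp_le {μ : Measure H} {a : H} {R : H →L[ℝ] H}
    {m : Measure H} (hμ : HasLevyTriplet μ a R m) {α : ℝ} (hα : 1 < α) (u : H)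
    {F : H → ℝ≥0∞} (hF : Measurable F) :
    ∫⁻ x, F (x + sqrtOp R u) ∂μ ≤ shiftConst α ‖u‖ * (∫⁻ x, F x ^ α ∂μ) ^ (1 / α) := by
  have hprob := hμ.isProbabilityMeasure
  have hR := hμ.posTraceClass.1
  have hS := (sqrtOp_spec hR).1
  -- Normalised so that Cauchy-Schwarz gives `⟨h, ξ⟩² ≤ ‖R^{1/2}ξ‖² = ⟨ξ, Rξ⟩`, leaving `‖u‖` as the
  -- shift length. For `u = 0` the convention `0⁻¹ = 0` gives `h = 0`.
  set h := ‖u‖⁻¹ • sqrtOp R u with hdef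
  have hu : sqrtOp R u = ‖u‖ • h := by
    rcases eq_or_ne u 0 with rfl | hu
    · simp
    · rw [hdef, smul_smul, mul_inv_cancel₀ (norm_ne_zero_iff.2 hu), one_smul]
  have hh : ∀ ξ, ⟪h, ξ⟫_ℝ ^ 2 ≤ ⟪ξ, R ξ⟫_ℝ := fun ξ => by
    have h1 : ⟪sqrtOp R u, ξ⟫_ℝ = ⟪u, sqrtOp R ξ⟫_ℝ := hS.inner_left_eq_inner_right _ _
    rw [← inner_sqrtOp_self hR, hdef, real_inner_smul_left, h1, ← sq_abs, abs_mul, abs_inv,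
      abs_norm]
    refine pow_le_pow_left₀ (by positivity) ?_ 2
    refine (mul_le_mul_of_nonneg_left (abs_real_inner_le_norm u _) (by positivity)).trans ?_
    rw [← mul_assoc]
    exact mul_le_of_le_one_left (norm_nonneg _) (inv_mul_le_one_of_le₀ le_rfl (norm_nonneg _))
  have hρ : IsProbabilityMeasure (μ.map (fun x => x + ‖u‖ • h)) :=
    Measure.isProbabilityMeasure_map (by fun_prop)
  have key := lintegral_le_of_boundedContinuous (μ := μ) (ρ := μ.map (fun x => x + ‖u‖ • h)) hα
    (K := shiftConst α ‖u‖) (fun g => ?_) ENNReal.ofReal_ne_top hF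
  · rwa [lintegral_map hF (by fun_prop), ← hu] at key
  · rw [lintegral_map (g.continuous.measurable.coe_nnreal_ennreal) (by fun_prop)]
    exact hμ.lintegral_boundedContinuous_add_le hα hh ‖u‖ g

end Shift

/-! ### Harnack inequality and hypercontractivity -/

section Harnack

/-- The weight in `hyperConst` is exactly the inverse of the shift constant raised to the power `α`.
-/
lemma shiftConst_rpow_mul_exp {E : Type*} [NormedAddCommGroup E] {α : ℝ} (hα : 1 < α) (u : E) :
    shiftConst α ‖u‖ ^ α * EReal.exp
      (-((ENNReal.ofReal (α / (2 * (α - 1))) * ‖u‖ₑ ^ 2 : ℝ≥0∞) : EReal)) = 1 := by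
  have hα1 : 0 < α - 1 := by linarith
  have e : (ENNReal.ofReal (α / (2 * (α - 1))) * ‖u‖ₑ ^ 2 : ℝ≥0∞)
      = ENNReal.ofReal (α / (2 * (α - 1)) * ‖u‖ ^ 2) := by
    rw [ENNReal.ofReal_mul (by positivity), ENNReal.ofReal_pow (norm_nonneg u), ofReal_norm]
  rw [e, EReal.coe_ennreal_ofReal, max_eq_left (by positivity), ← EReal.coe_neg, EReal.exp_coe,
    shiftConst, ENNReal.ofReal_rpow_of_pos (Real.exp_pos _),
    ← ENNReal.ofReal_mul (by positivity), ← Real.exp_mul, ← Real.exp_add, ← ENNReal.ofReal_one]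
  congr 1
  rw [Real.exp_eq_one_iff]
  ring

variable {H : Type*} [NormedAddCommGroup H] [InnerProductSpace ℝ H]
  [MeasurableSpace H] [BorelSpace H] [SecondCountableTopology H]

/-- If `(ν_t)` is an evolution system of measures, then `ν_t` is the law of `U(t,s) X + Y` for
independent `X ∼ ν_s` and `Y ∼ μ_{t,s}`. -/
lemma IsEvolutionSystem.measurePreserving {U : ℝ → ℝ → H →L[ℝ] H} {μ : ℝ → ℝ → Measure H}
    {ν : ℝ → Measure H} (hν : IsEvolutionSystem U μ ν) {s t : ℝ} (hst : s ≤ t)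
    [IsProbabilityMeasure (μ t s)] :
    MeasurePreserving (fun p : H × H => U t s p.1 + p.2) ((ν s).prod (μ t s)) (ν t) := by
  have := hν.isProbabilityMeasure s
  have := hν.isProbabilityMeasure t
  have hT : Measurable fun p : H × H => U t s p.1 + p.2 := by fun_prop
  refine ⟨hT, ?_⟩
  have := Measure.isProbabilityMeasure_map (μ := (ν s).prod (μ t s)) hT.aemeasurable
  refine Measure.ext fun A hA => ?_
  rw [← measureReal_eq_measureReal_iff]
  have hm : Measurable (A.indicator (1 : H → ℝ)) := measurable_one.indicator hA
  have hb : ∀ x, |A.indicator (1 : H → ℝ) x| ≤ 1 := fun x => by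
    by_cases hx : x ∈ A <;> simp [hx]
  have h := hν.integral_mehler s t hst (A.indicator 1) hm ⟨1, hb⟩
  rw [integral_indicator_one hA] at h
  rw [← h, ← integral_indicator_one hA, integral_map hT.aemeasurable hm.aestronglyMeasurable,
    integral_prod]
  · rfl
  · exact (integrable_const (1 : ℝ)).mono' (hm.comp hT).aestronglyMeasurable
      (ae_of_all _ fun p => hb _)

variable [CompleteSpace H]

/-- Wang's Harnack inequality for the generalized Mehler semigroup. -/
theorem harnack {U R : ℝ → ℝ → H →L[ℝ] H} {s t : ℝ} {μ : Measure H} {a : H} {m : Measure H}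
    (hμ : HasLevyTriplet μ a (R t s) m) {α : ℝ} (hα : 1 < α) {F : H → ℝ≥0∞} (hF : Measurable F)
    (x y : H) :
    (∫⁻ z, F (U t s x + z) ∂μ) ^ α * EReal.exp
        (-((ENNReal.ofReal (α / (2 * (α - 1))) * gammaNorm U R t s (x - y) ^ 2 : ℝ≥0∞) : EReal))
      ≤ ∫⁻ z, F (U t s y + z) ^ α ∂μ := by
  have hα0 : 0 < α := by linarith
  have hα1 : 0 < α - 1 := by linarith
  rw [gammaNorm]
  split_ifs with hr
  -- Any preimage under `R^{1/2}` would give such a bound; orthogonality to the kernel only makes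
  -- its norm minimal.
  · obtain ⟨-, hu⟩ := pseudoInverse_spec (sqrtOp (R t s)) hr
    set u := pseudoInverse (sqrtOp (R t s)) (U t s (x - y))
    have h := hμ.lintegral_add_sqrtOp_le hα u (F := fun z => F (U t s y + z)) (by fun_prop)
    have e : ∀ z, U t s y + (z + sqrtOp (R t s) u) = U t s x + z := fun z => by
      rw [hu, map_sub]
      abel
    simp only [e] at h
    have h2 := ENNReal.rpow_le_rpow h hα0.le
    rw [ENNReal.mul_rpow_of_nonneg _ _ hα0.le, ← ENNReal.rpow_mul, one_div,
      inv_mul_cancel₀ hα0.ne', ENNReal.rpow_one] at h2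
    refine (mul_le_mul_left h2 _).trans_eq ?_
    rw [mul_right_comm, shiftConst_rpow_mul_exp hα, one_mul]
  -- Here `|Γ| = ∞`; a nonzero coefficient keeps the exponent at `-∞`, so the left side is `0`.
  · have : ENNReal.ofReal (α / (2 * (α - 1))) ≠ 0 := by
      rw [ne_eq, ENNReal.ofReal_eq_zero, not_le]
      positivity
    simp [this]

/-- Hypercontractivity estimate on non-negative functions. -/
theorem lintegral_rpow_le_hyperConst {U R : ℝ → ℝ → H →L[ℝ] H} {μ : ℝ → ℝ → Measure H}
    {ν : ℝ → Measure H} (hν : IsEvolutionSystem U μ ν) {s t : ℝ} (hst : s ≤ t) {a : H}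
    {m : Measure H} (hμ : HasLevyTriplet (μ t s) a (R t s) m) {α ε : ℝ} (hα : 1 < α) (hε : 0 < ε)
    {F : H → ℝ≥0∞} (hF : Measurable F) (h0 : ∫⁻ x, F x ^ α ∂(ν t) ≠ 0)
    (hfin : ∫⁻ x, F x ^ α ∂(ν t) ≠ ∞) :
    ∫⁻ x, (∫⁻ z, F (U t s x + z) ∂(μ t s)) ^ (α * (1 + ε)) ∂(ν s)
      ≤ (∫⁻ x, F x ^ α ∂(ν t)) ^ (1 + ε) * hyperConst U R ν s t α ε := by
  have := hμ.isProbabilityMeasure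
  have := hν.isProbabilityMeasure s
  have hε1 : 0 ≤ 1 + ε := by linarith
  have hN : ∫⁻ y, ∫⁻ z, F (U t s y + z) ^ α ∂(μ t s) ∂(ν s) = ∫⁻ x, F x ^ α ∂(ν t) := by
    rw [← (hν.measurePreserving hst).lintegral_comp (hF.pow_const α),
      lintegral_prod _ (by fun_prop)]
  rw [hyperConst, ← lintegral_const_mul' _ _ (ENNReal.rpow_ne_top_of_nonneg hε1 hfin)]
  refine lintegral_mono fun x => ?_
  simp only
  rw [ENNReal.rpow_mul, ENNReal.rpow_neg, ← div_eq_mul_inv,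
    ← ENNReal.div_rpow_of_nonneg _ _ hε1]
  refine ENNReal.rpow_le_rpow ?_ hε1
  -- The integral of the weight may be zero; division remains legitimate because the numerator is
  -- neither `0` nor `∞`.
  rw [ENNReal.le_div_iff_mul_le (Or.inr h0) (Or.inr hfin), ← hN]
  -- This direction of pulling out a constant needs no measurability of `y ↦ |Γ(x - y)|`.
  exact (lintegral_const_mul_le _ _).trans (lintegral_mono fun y => harnack hμ hα hF x y)

end Harnack

end Mehler

/-! ### The estimate on `L^α(ν_t)` -/

theorem mainTheorem11 {H : Type*} [NormedAddCommGroup H] [InnerProductSpace ℝ H] [CompleteSpace H]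
    [SecondCountableTopology H] [MeasurableSpace H] [BorelSpace H]
    (U : ℝ → ℝ → H →L[ℝ] H) (hU : Mehler.IsEvolutionFamily U)
    (μ : ℝ → ℝ → Measure H) (a : ℝ → ℝ → H) (R : ℝ → ℝ → H →L[ℝ] H) (m : ℝ → ℝ → Measure H)
    (hμ : ∀ s t, s ≤ t → Mehler.HasLevyTriplet (μ t s) (a t s) (R t s) (m t s))
    (hskew : Mehler.SkewConvolution U μ)
    (ν : ℝ → Measure H) (hν : Mehler.IsEvolutionSystem U μ ν)
    (s t : ℝ) (hst : s ≤ t) (α ε : ℝ) (hα : 1 < α) (hε : 0 < ε)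
    (f : H → ℝ) (hf : MemLp f (ENNReal.ofReal α) (ν t)) :
    (∀ᵐ x ∂(ν s), Integrable (fun y => f (U t s x + y)) (μ t s)) ∧
    AEStronglyMeasurable (Mehler.mehler U μ s t f) (ν s) ∧
    eLpNorm (Mehler.mehler U μ s t f) (ENNReal.ofReal (α * (1 + ε))) (ν s) ≤
      Mehler.hyperConst U R ν s t α ε ^ (1 / (α * (1 + ε))) *
        eLpNorm f (ENNReal.ofReal α) (ν t) := by
  have hμst := hμ s t hst
  have := hμst.isProbabilityMeasure
  have := hν.isProbabilityMeasure s
  have := hν.isProbabilityMeasure t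
  have hα0 : 0 < α := by linarith
  have hε1 : 0 < 1 + ε := by linarith
  have hT := hν.measurePreserving hst
  have hf1 : Integrable f (ν t) :=
    hf.integrable (by simpa using ENNReal.ofReal_le_ofReal hα.le)
  have hfT : Integrable (fun p : H × H => f (U t s p.1 + p.2)) ((ν s).prod (μ t s)) :=
    hT.integrable_comp_of_integrable hf1
  refine ⟨hfT.prod_right_ae, hfT.aestronglyMeasurable.integral_prod_right', ?_⟩
  -- A measurable version of `|f|`; measure preservation of `(x, y) ↦ U(t,s)x + y` transports the
  -- exceptional null set to `ν s ⊗ μ t s`.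
  obtain ⟨F, hF, hFf⟩ : ∃ F : H → ℝ≥0∞, Measurable F ∧ ∀ᵐ x ∂(ν t), ‖f x‖ₑ = F x :=
    ⟨_, hf.1.enorm.measurable_mk, hf.1.enorm.ae_eq_mk⟩
  have hnorm : eLpNorm f (ENNReal.ofReal α) (ν t) = (∫⁻ x, F x ^ α ∂(ν t)) ^ (1 / α) := by
    rw [eLpNorm_eq_lintegral_rpow_enorm_toReal (by simpa using hα0) ENNReal.ofReal_ne_top,
      ENNReal.toReal_ofReal hα0.le]
    congr 1
    exact lintegral_congr_ae (hFf.mono fun x hx => by simp only [hx])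
  have hle : ∀ᵐ x ∂(ν s), ‖Mehler.mehler U μ s t f x‖ₑ ≤ ∫⁻ z, F (U t s x + z) ∂(μ t s) := by
    filter_upwards [Measure.ae_ae_of_ae_prod (hT.quasiMeasurePreserving.ae hFf)] with x hx
    exact (enorm_integral_le_lintegral_enorm _).trans_eq (lintegral_congr_ae hx)
  have hβ : 0 < α * (1 + ε) := by positivity
  have hbound : eLpNorm (Mehler.mehler U μ s t f) (ENNReal.ofReal (α * (1 + ε))) (ν s) ≤
      (∫⁻ x, (∫⁻ z, F (U t s x + z) ∂(μ t s)) ^ (α * (1 + ε)) ∂(ν s)) ^ (1 / (α * (1 + ε))) := by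
    rw [eLpNorm_eq_lintegral_rpow_enorm_toReal (by simpa using hβ) ENNReal.ofReal_ne_top,
      ENNReal.toReal_ofReal hβ.le]
    refine ENNReal.rpow_le_rpow (lintegral_mono_ae (hle.mono fun x hx => ?_)) (by positivity)
    exact ENNReal.rpow_le_rpow hx hβ.le
  refine hbound.trans ?_
  -- When `f = 0` almost everywhere the constant may be `∞`, so the left side is shown to vanish
  -- directly.
  by_cases h0 : ∫⁻ x, F x ^ α ∂(ν t) = 0
  · have hz : ∀ᵐ x ∂(ν t), F x = 0 := by
      filter_upwards [(lintegral_eq_zero_iff (hF.pow_const α)).1 h0] with x hx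
      exact (ENNReal.rpow_eq_zero_iff_of_pos hα0).1 hx
    have hz' : ∀ᵐ x ∂(ν s), (∫⁻ z, F (U t s x + z) ∂(μ t s)) ^ (α * (1 + ε)) = 0 := by
      filter_upwards [Measure.ae_ae_of_ae_prod (hT.quasiMeasurePreserving.ae hz)] with x hx
      rw [lintegral_congr_ae hx, lintegral_zero, ENNReal.zero_rpow_of_pos hβ]
    rw [lintegral_congr_ae hz', lintegral_zero, ENNReal.zero_rpow_of_pos (by positivity)]
    exact zero_le
  · have hfin : ∫⁻ x, F x ^ α ∂(ν t) ≠ ∞ := fun h => by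
      have := hf.2
      rw [hnorm, h, ENNReal.top_rpow_of_pos (by positivity)] at this
      exact this.ne rfl
    refine (ENNReal.rpow_le_rpow
      (Mehler.lintegral_rpow_le_hyperConst hν hst hμst hα hε hF h0 hfin)
      (by positivity : 0 ≤ 1 / (α * (1 + ε)))).trans_eq ?_
    rw [ENNReal.mul_rpow_of_nonneg _ _ (by positivity), ← ENNReal.rpow_mul, hnorm, mul_comm]
    congr 2
    field_simp
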